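/- An LLM Markov category $(\mathcal L,\otimes,I)$ is a (small) symmetric monoidal category in which every object $X$ carries a commutative comonoid structure $\mathsf{copy}_X : X\to X\otimes X$, $\mathsf{del}_X : X\to I$, compatible with the monoidal structure, and such that $\mathsf{del}$ is natural: $\mathsf{del}_Y\circ f=\mathsf{del}_X$ for every morphism $f : X\to Y$. Its classifying space $B\mathcal L$ is the geometric realization of its nerve; an object $X$ gives a point $[X]\in B\mathcal L$, and a functor $F$ induces a continuous map $B(F)$. For spaces $X,Y$ let $X\times_k Y$ be the product of compactly generated spaces, i.e. the set $X\times Y$ with the $k$-ification of the product topology. An H-space is a space $X$ with a base point $x_0$ and a continuous map $m : X\times X\to X$ with $m(x_0,x_0)=x_0$ such that $m(x_0,\cdot)$ and $m(\cdot,x_0)$ are homotopic to $\mathrm{id}_X$ by homotopies that preserve $x_0$; it is associative (commutative) if $m$ is associative (commutative) up to homotopy. **Theorem.** Let $\mathcal L$ be a (small) LLM Markov category. Then the map $B(\mathcal L\times\mathcal L)\to B\mathcal L\times_k B\mathcal L$ induced by the two projections is a homeomorphism. Hence $\otimes$ induces a continuous multiplication $$\mu : B\mathcal L\times_k B\mathcal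 L\;\cong\; B(\mathcal L\times\mathcal L)\xrightarrow{\;B(\otimes)\;}B\mathcal L .$$ With $e=[I]$, the following hold. 1. $\mu$ has $e$ as a two-sided unit up to homotopy: there are homotopies $\mu(e,\cdot)\simeq\mathrm{id}$ and $\mu(\cdot,e)\simeq\mathrm{id}$ that move the point $e$ along one and the same path from $\mu(e,e)=[I\otimes I]$ to $e$. If $\mu(e,e)=e$ (for instance if $I\otimes I=I$), both homotopies can be chosen to preserve the base point $e$. 2. $\mu$ is associative up to homotopy and commutative up to homotopy. 3. $B\mathcal L$ is an associative and commutative H-space: there is a continuous map $m : B\mathcal L\times B\mathcal L\to B\mathcal L$ (on the topological product) which, with base point $e$, makes $B\mathcal L$ an associative and commutative H-space, and whose composite with the identity map $B\mathcal L\times_k B\mathcal L\to B\mathcal L\times B\mathcal L$ is homotopic to $\mu$. -/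

import Mathlib

open CategoryTheory MonoidalCategory Topology
open scoped unitInterval Simplicial

universe u v w

noncomputable section

/-! ### Products of compactly generated spaces -/

/-- The product of two spaces in the category of compactly generated spaces: the set `X × Y` with
the finest topology for which every continuous map from a compact Hausdorff space to the
topological product `X × Y` is still continuous (the `k`-ification of the product topology). -/
abbrev KProd (X Y : Type w) [TopologicalSpace X] [TopologicalSpace Y] : Type w :=
  WithGeneratedByTopology (fun K : CompHaus.{w} ↦ (K : Type w)) (X × Y)

namespace KProd

variable {X Y : Type w} [TopologicalSpace X] [TopologicalSpace Y]

/-- The point `(x, y)` of the product. -/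
def pair (x : X) (y : Y) : KProd X Y := WithGeneratedByTopology.equiv.symm (x, y)

/-- The identity of `X × Y`, as a continuous map to the topological product. -/
def toProd : C(KProd X Y, X × Y) :=
  ⟨WithGeneratedByTopology.equiv, WithGeneratedByTopology.continuous_equiv⟩

/-- The first projection. -/
def fst : C(KProd X Y, X) := ContinuousMap.fst.comp toProd

/-- The second projection. -/
def snd : C(KProd X Y, Y) := ContinuousMap.snd.comp toProd

/-- The map `z ↦ (f z, g z)` out of a compactly generated space. -/
def lift {Z : Type w} [TopologicalSpace Z]
    [IsGeneratedBy (fun K : CompHaus.{w} ↦ (K : Type w)) Z] (f : C(Z, X)) (g : C(Z, Y)) :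
    C(Z, KProd X Y) :=
  ⟨fun z ↦ pair (f z) (g z),
    (IsGeneratedBy.equiv_symm_comp_continuous_iff
      (X := fun K : CompHaus.{w} ↦ (K : Type w)) (fun z ↦ (f z, g z))).2 (by fun_prop)⟩

end KProd

/-! ### Multiplications up to homotopy -/

/-- `e` is a two-sided unit up to homotopy for `μ`, by homotopies `μ(e, ·) ≃ id` and
`μ(·, e) ≃ id` both of which move the point `e` along `γ`. The homotopies preserve the base point
`e` if `γ` is constant with value `e`. -/
def HUnitalAlong {X : Type w} [TopologicalSpace X] (μ : C(KProd X X, X)) (e : X)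
    (γ : C(I, X)) : Prop :=
  (∃ H : C(I × X, X), (∀ x, H (0, x) = μ (KProd.pair e x)) ∧ (∀ x, H (1, x) = x) ∧
    ∀ t, H (t, e) = γ t) ∧
  (∃ H : C(I × X, X), (∀ x, H (0, x) = μ (KProd.pair x e)) ∧ (∀ x, H (1, x) = x) ∧
    ∀ t, H (t, e) = γ t)

/-- `μ` is associative up to homotopy: `μ(x, μ(y, z)) ≃ μ(μ(x, y), z)`. -/
def HAssociative {X : Type w} [TopologicalSpace X] (μ : C(KProd X X, X)) : Prop :=
  let x : C(KProd X (KProd X X), X) := KProd.fst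
  let y : C(KProd X (KProd X X), X) := KProd.fst.comp KProd.snd
  let z : C(KProd X (KProd X X), X) := KProd.snd.comp KProd.snd
  (μ.comp (KProd.lift x (μ.comp (KProd.lift y z)))).Homotopic
    (μ.comp (KProd.lift (μ.comp (KProd.lift x y)) z))

/-- `μ` is commutative up to homotopy: `μ(x, y) ≃ μ(y, x)`. -/
def HCommutative {X : Type w} [TopologicalSpace X] (μ : C(KProd X X, X)) : Prop :=
  μ.Homotopic (μ.comp (KProd.lift KProd.snd KProd.fst))

/-- An H-space (with its multiplication defined on the topological product) is associative if its
multiplication is associative up to homotopy. -/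
def HSpace.IsAssociative {X : Type w} [TopologicalSpace X] (h : HSpace X) : Prop :=
  let x : C(X × X × X, X) := ContinuousMap.fst
  let y : C(X × X × X, X) := ContinuousMap.fst.comp ContinuousMap.snd
  let z : C(X × X × X, X) := ContinuousMap.snd.comp ContinuousMap.snd
  (h.hmul.comp (x.prodMk (h.hmul.comp (y.prodMk z)))).Homotopic
    (h.hmul.comp ((h.hmul.comp (x.prodMk y)).prodMk z))

/-- An H-space is commutative if its multiplication is commutative up to homotopy. -/
def HSpace.IsCommutative {X : Type w} [TopologicalSpace X] (h : HSpace X) : Prop :=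
  h.hmul.Homotopic (h.hmul.comp (ContinuousMap.snd.prodMk ContinuousMap.fst))

/-! ### Classifying spaces -/

/-- The classifying space of a category: the geometric realization of its nerve. -/
abbrev ClassifyingSpace (C : Type u) [Category.{v} C] : Type (max u v) :=
  SSet.toTop.{max u v}.obj (nerve C)

namespace ClassifyingSpace

variable {C D : Type u} [Category.{v} C] [Category.{v} D]

/-- The continuous map of classifying spaces induced by a functor. -/
def map (F : C ⥤ D) : C(ClassifyingSpace C, ClassifyingSpace D) :=
  (SSet.toTop.map (nerveMap F)).hom

/-- The point of the classifying space given by an object, i.e. by a `0`-simplex of the nerve. -/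
def vertex (x : C) : ClassifyingSpace C :=
  TopCat.toSSetObj₀Equiv ((sSetTopAdj.unit.app (nerve C)).app (Opposite.op ⦋0⦌)
    (ComposableArrows.mk₀ x))

variable (C D) in
/-- The canonical map `B(C × D) → BC × BD` whose components are induced by the projections. -/
def comparison (z : ClassifyingSpace (C × D)) :
    KProd (ClassifyingSpace C) (ClassifyingSpace D) :=
  KProd.pair (map (CategoryTheory.Prod.fst C D) z) (map (CategoryTheory.Prod.snd C D) z)

end ClassifyingSpace

end

noncomputable section

/-! A point of |X| × |Y| is given by points s, t of two topological simplices. Cutting [0,1] at the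
cumulative weights of both exhibits s and t as images, under monotone maps, of one interior point of
a third simplex, and any two such choices agree after a further refinement. This defines the inverse
of |X × Y| → |X| × |Y| (`exists_refinement`, `simplexMap_pairSimplex_eq`). It is continuous on each
Δⁿ × Δᵐ, which is a quotient of finitely many simplices, hence continuous for the k-topology, where
the exponential law lets continuity descend along a quotient map in each factor. For nerves this
gives B(C × D) ≅ BC ×ₖ BD.

A natural transformation is a simplicial homotopy of nerves, so it induces a homotopy that moves
each vertex along the edge of the corresponding component (`ClassifyingSpace.exists_homotopy`).
Unitors, associator and braiding thus give the homotopies for μ.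

Naturality of del makes the unit object terminal, so BL contracts to e with e fixed, and any two
maps into BL are homotopic. What remains for the H-space is a map on the topological product, where
μ need not be continuous, with unit homotopies fixing e. `HSpace.contractionMul` builds it from the
contraction and the barycentric weight of the unit object, a continuous function with value 1 at e.
-/

/-- The topological simplex indexed by an object of the simplex category. -/
abbrev TopSimplex (n : SimplexCategory) : Type := _root_.stdSimplex ℝ (Fin (n.len + 1))

/-! ### Realization as a quotient of a sum of simplices -/

namespace SSet

open Opposite

variable {X Y : SSet.{u}} {n m : SimplexCategory}

/-- The characteristic map of a simplex, from the topological simplex to the realization. -/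
def simplexMap (x : X.obj (op n)) : C(TopSimplex n, |X|) :=
  TopCat.toSSetObjEquiv |X| (op n) ((sSetTopAdj.unit.app X).app (op n) x)

lemma simplexMap_map (f : m ⟶ n) (x : X.obj (op n)) (t : TopSimplex m) :
    simplexMap (X.map f.op x) t = simplexMap x (_root_.stdSimplex.map f t) := by
  have h := ConcreteCategory.congr_hom ((sSetTopAdj.unit.app X).naturality f.op) x
  exact congrArg (fun a ↦ TopCat.toSSetObjEquiv |X| (op m) a t) h

lemma toTop_map_simplexMap (F : X ⟶ Y) (x : X.obj (op n))
    (t : TopSimplex n) :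
    SSet.toTop.map F (simplexMap x t) = simplexMap (F.app _ x) t := by
  have h := ConcreteCategory.congr_hom (congr_app (sSetTopAdj.unit.naturality F) (op n)) x
  simp only [simplexMap]
  exact (congrArg (fun a ↦ TopCat.toSSetObjEquiv |Y| (op n) a t) h).symm

/-- A family of maps on topological simplices, compatible with the simplicial operators, induces
a map on the realization. -/
def realizationDesc {T : Type u} [TopologicalSpace T]
    (f : ∀ (n : SimplexCategory), X.obj (op n) → C(TopSimplex n, T))
    (hf : ∀ ⦃m n : SimplexCategory⦄ (φ : m ⟶ n) (x : X.obj (op n)) t,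
      f m (X.map φ.op x) t = f n x (_root_.stdSimplex.map φ t)) : C(|X|, T) :=
  ((sSetTopAdj.homEquiv X (TopCat.of T)).symm
    { app n := ↾fun x ↦ (TopCat.toSSetObjEquiv (TopCat.of T) n).symm (f n.unop x)
      naturality m n φ := by
        ext x
        refine (TopCat.toSSetObjEquiv (TopCat.of T) n).injective ?_
        ext t
        exact hf φ.unop x t }).hom

lemma realizationDesc_simplexMap {T : Type u} [TopologicalSpace T]
    (f : ∀ (n : SimplexCategory), X.obj (op n) → C(TopSimplex n, T))
    (hf : ∀ ⦃m n : SimplexCategory⦄ (φ : m ⟶ n) (x : X.obj (op n)) t,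
      f m (X.map φ.op x) t = f n x (_root_.stdSimplex.map φ t))
    (x : X.obj (op n)) (t : TopSimplex n) :
    realizationDesc f hf (simplexMap x t) = f n x t := by
  let F : X ⟶ TopCat.toSSet.obj (TopCat.of T) :=
    { app n := ↾fun x ↦ (TopCat.toSSetObjEquiv (TopCat.of T) n).symm (f n.unop x)
      naturality m n φ := by
        ext x
        refine (TopCat.toSSetObjEquiv (TopCat.of T) n).injective ?_
        ext t
        exact hf φ.unop x t }
  have h : sSetTopAdj.homEquiv X (TopCat.of T) ((sSetTopAdj.homEquiv X (TopCat.of T)).symm F) = F :=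
    Equiv.apply_symm_apply _ _
  rw [Adjunction.homEquiv_unit] at h
  exact congrArg (fun a ↦ TopCat.toSSetObjEquiv (TopCat.of T) (op n) a t)
    (ConcreteCategory.congr_hom (congr_app h (op n)) x)

lemma realization_hom_ext {T : Type u} [TopologicalSpace T] {f g : C(|X|, T)}
    (h : ∀ (n : SimplexCategory) (x : X.obj (op n)) t, f (simplexMap x t) = g (simplexMap x t)) :
    f = g := by
  suffices TopCat.ofHom f = TopCat.ofHom g from congrArg TopCat.Hom.hom this
  apply (sSetTopAdj.homEquiv X (TopCat.of T)).injective
  simp only [Adjunction.homEquiv_unit]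
  ext n x
  refine (TopCat.toSSetObjEquiv (TopCat.of T) n).injective ?_
  ext t
  exact h n.unop x t

/-- Into an indiscrete space every map is continuous, so `realization_hom_ext` identifies the
indicator of the union of all simplices with the constant `True`. -/
lemma exists_simplexMap_eq (z : |X|) :
    ∃ (n : SimplexCategory) (x : X.obj (op n)) (t : TopSimplex n),
      simplexMap x t = z := by
  let _ : TopologicalSpace (ULift.{u} Prop) := ⊤
  let f : C(|X|, ULift.{u} Prop) := ⟨fun z ↦ ⟨∃ (n : SimplexCategory) (x : X.obj (op n))
    (t : TopSimplex n), simplexMap x t = z⟩, continuous_top⟩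
  have h : f = ⟨fun _ ↦ ⟨True⟩, continuous_top⟩ := by
    refine realization_hom_ext fun n x t ↦ ?_
    simp only [f, ContinuousMap.coe_mk, ULift.up_inj, eq_iff_iff, iff_true]
    exact ⟨n, x, t, rfl⟩
  have := congrArg ULift.down (DFunLike.congr_fun h z)
  exact this.mpr trivial

/-- The set-theoretic version of `realizationDesc`. -/
lemma exists_desc {T : Type u}
    (f : ∀ (n : SimplexCategory), X.obj (op n) → TopSimplex n → T)
    (hf : ∀ ⦃m n : SimplexCategory⦄ (φ : m ⟶ n) (x : X.obj (op n)) t,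
      f m (X.map φ.op x) t = f n x (_root_.stdSimplex.map φ t)) :
    ∃ g : |X| → T, ∀ (n : SimplexCategory) (x : X.obj (op n)) t, g (simplexMap x t) = f n x t := by
  let _ : TopologicalSpace T := ⊤
  exact ⟨realizationDesc (fun n x ↦ ⟨f n x, continuous_top⟩) hf,
    fun n x t ↦ realizationDesc_simplexMap _ _ x t⟩

variable (X) in
/-- The disjoint union of topological simplices of which `|X|` is a quotient. -/
abbrev SimplexSum : Type u :=
  Σ x : (Σ n : SimplexCategory, X.obj (op n)), TopSimplex x.1

variable (X) in
/-- The quotient map onto the realization. -/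
def sumMap (z : SimplexSum X) : |X| := simplexMap z.1.2 z.2

/-- Open sets are continuous maps to the Sierpiński space `Prop`: a set with open preimage has
compatible indicators on the simplices, which glue by the universal property. -/
lemma isQuotientMap_sumMap : IsQuotientMap (sumMap X) := by
  have hc : Continuous (sumMap X) := by
    rw [continuous_sigma_iff]
    exact fun x ↦ (simplexMap x.2).continuous
  refine ⟨isCoinducing_iff.2 fun s ↦ ⟨fun hs ↦ ?_, fun hs ↦ hs.preimage hc⟩, fun z ↦ ?_⟩
  · let _ : TopologicalSpace (ULift.{u} Prop) := .induced ULift.down inferInstance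
    let g : C(|X|, ULift.{u} Prop) := realizationDesc
      (fun n x ↦ ⟨fun t ↦ ⟨simplexMap x t ∈ s⟩, continuous_induced_rng.2 <|
        continuous_Prop.2 (isOpen_sigma_iff.1 hs ⟨n, x⟩)⟩)
      (fun m n φ x t ↦ by simp [simplexMap_map])
    have hg : ∀ z, (g z).down = (z ∈ s) := by
      intro z
      obtain ⟨n, x, t, rfl⟩ := exists_simplexMap_eq z
      exact congrArg ULift.down (realizationDesc_simplexMap _ _ x t)
    have : Continuous fun z ↦ (g z).down := continuous_induced_dom.comp g.continuous
    simp only [hg] at this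
    exact continuous_Prop.1 this
  · obtain ⟨n, x, t, rfl⟩ := exists_simplexMap_eq z
    exact ⟨⟨⟨n, x⟩, t⟩, rfl⟩

lemma realization_continuous_iff {T : Type*} [TopologicalSpace T] {g : |X| → T} :
    Continuous g ↔ ∀ (n : SimplexCategory) (x : X.obj (op n)), Continuous (g ∘ simplexMap x) := by
  rw [isQuotientMap_sumMap.continuous_iff, continuous_sigma_iff]
  exact ⟨fun h n x ↦ h ⟨n, x⟩, fun h x ↦ h x.1 x.2⟩

end SSet

/-! ### Monotone maps and common refinements of points of simplices -/

namespace stdSimplex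

variable {α β : Type*} [Fintype α] [Fintype β]

lemma map_apply [DecidableEq β] (f : α → β) (s : stdSimplex ℝ α) (y : β) :
    map f s y = ∑ x with f x = y, s x := by
  rw [map_coe, FunOnFinite.linearMap_apply_apply]

lemma sum_filter_map (c : α → β) (v : stdSimplex ℝ α) (p : β → Prop) [DecidablePred p] :
    ∑ y with p y, map c v y = ∑ x with p (c x), v x := by
  classical
  simp only [map_apply]
  rw [← Finset.sum_fiberwise_of_maps_to (s := {x | p (c x)}) (t := {y | p y}) (g := c) (by simp)]
  refine Finset.sum_congr rfl fun y hy ↦ Finset.sum_congr ?_ fun _ _ ↦ rfl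
  ext x
  simp only [Finset.mem_filter, Finset.mem_univ, true_and] at hy ⊢
  exact ⟨fun h ↦ ⟨h ▸ hy, h⟩, fun h ↦ h.2⟩

/-- A monotone map to a linear order is determined by the image of a point in the interior of
the simplex. -/
lemma eq_of_map_eq [LinearOrder α] [LinearOrder β] {a b : α → β} (ha : Monotone a)
    (hb : Monotone b) {v : stdSimplex ℝ α} (hv : ∀ i, 0 < v i) (h : map a v = map b v) :
    a = b := by
  suffices H : ∀ {a b : α → β}, Monotone a → Monotone b → map a v = map b v → ∀ i, a i ≤ b i from
    funext fun i ↦ le_antisymm (H ha hb h i) (H hb ha h.symm i)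
  intro a b ha hb h i
  by_contra! hi
  -- If `b i < a i`, then `{a ≤ b i}` is contained in `{b ≤ b i}` and misses `i`, so it has strictly
  -- smaller mass.
  have h1 := sum_filter_map a v (· ≤ b i)
  rw [h, sum_filter_map b] at h1
  refine absurd h1 (ne_of_gt (Finset.sum_lt_sum_of_subset (i := i) ?_ ?_ ?_ (hv i) ?_))
  · intro x hx
    simp only [Finset.mem_filter, Finset.mem_univ, true_and] at hx ⊢
    exact hb (not_lt.1 fun hix ↦ absurd (hi.trans_le (ha hix.le)) (not_lt.2 hx))
  · simp
  · simpa using hi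
  · exact fun j _ _ ↦ (hv j).le

end stdSimplex

namespace Fin

lemma sum_filter_castSucc_lt_succ {n : ℕ} (f : Fin n → ℝ) (j : Fin n) :
    ∑ i with castSucc i < j.succ, f i = (∑ i with castSucc i < j.castSucc, f i) + f j := by
  have : (Finset.univ.filter fun i : Fin n ↦ castSucc i < j.succ) =
      insert j (Finset.univ.filter fun i : Fin n ↦ castSucc i < j.castSucc) := by
    ext i
    simp only [Finset.mem_filter, Finset.mem_univ, true_and, Finset.mem_insert, Fin.lt_def,
      Fin.ext_iff, Fin.val_castSucc, Fin.val_succ]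
    lia
  rw [this, Finset.sum_insert (by simp), add_comm]

lemma sum_filter_castSucc_lt_sub {n : ℕ} (E : Fin (n + 1) → ℝ) (r : Fin (n + 1)) :
    ∑ i : Fin n with castSucc i < r, (E i.succ - E i.castSucc) = E r - E 0 := by
  induction r using Fin.induction with
  | zero => simp
  | succ j hj =>
    rw [sum_filter_castSucc_lt_succ, hj]
    ring

lemma exists_castSucc_le_lt_succ {n : ℕ} {f : Fin (n + 1) → ℝ} {x : ℝ} (h0 : f 0 ≤ x)
    (h1 : x < f (last n)) : ∃ j : Fin n, f j.castSucc ≤ x ∧ x < f j.succ := by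
  by_contra! h
  have : ∀ j, f j ≤ x := fun j ↦ by
    induction j using Fin.induction with
    | zero => exact h0
    | succ j hj => exact h j hj
  exact absurd h1 (not_lt.2 (this _))

end Fin

namespace stdSimplex

variable {n m k : ℕ}

/-- The cumulative weights of a point of a simplex. -/
def partialSum (w : stdSimplex ℝ (Fin n)) (j : Fin (n + 1)) : ℝ :=
  ∑ i with Fin.castSucc i < j, w i

lemma partialSum_zero (w : stdSimplex ℝ (Fin n)) : partialSum w 0 = 0 := by
  simp [partialSum]

lemma partialSum_last (w : stdSimplex ℝ (Fin n)) : partialSum w (Fin.last n) = 1 := by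
  simp [partialSum, Fin.castSucc_lt_last]

lemma partialSum_succ (w : stdSimplex ℝ (Fin n)) (j : Fin n) :
    partialSum w j.succ = partialSum w j.castSucc + w j :=
  Fin.sum_filter_castSucc_lt_succ _ _

lemma monotone_partialSum (w : stdSimplex ℝ (Fin n)) : Monotone (partialSum w) :=
  Fin.monotone_iff_le_succ.2 fun i ↦ by
    rw [partialSum_succ]
    exact le_add_of_nonneg_right (zero_le w i)

lemma partialSum_mem_Icc (w : stdSimplex ℝ (Fin n)) (j : Fin (n + 1)) :
    partialSum w j ∈ Set.Icc 0 1 :=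
  ⟨partialSum_zero w ▸ monotone_partialSum w (Fin.zero_le j),
    partialSum_last w ▸ monotone_partialSum w (Fin.le_last j)⟩

/-- The point of a simplex whose weights are the lengths of the pieces of a partition of the
unit interval. -/
def ofPartition (E : Fin (k + 1) → ℝ) (hE : Monotone E) (h0 : E 0 = 0) (h1 : E (Fin.last k) = 1) :
    stdSimplex ℝ (Fin k) :=
  ⟨fun i ↦ E i.succ - E i.castSucc, fun i ↦ sub_nonneg.2 (hE i.castSucc_le_succ), by
    simpa [Fin.castSucc_lt_last, h0, h1] using Fin.sum_filter_castSucc_lt_sub E (Fin.last k)⟩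

/-- If `E` cuts at every cumulative weight of `w`, each piece of `E` lies in a single piece of `w`,
and `g` sends it there. -/
lemma exists_map_ofPartition_eq (E : Fin (k + 1) → ℝ) (hE : StrictMono E) (h0 : E 0 = 0)
    (h1 : E (Fin.last k) = 1) (w : stdSimplex ℝ (Fin n)) (hw : ∀ j, partialSum w j ∈ Set.range E) :
    ∃ g : Fin k →o Fin n, map g (ofPartition E hE.monotone h0 h1) = w := by
  have hex (i : Fin k) : ∃ j : Fin n, partialSum w j.castSucc ≤ E i.castSucc ∧
      E i.castSucc < partialSum w j.succ := by
    refine Fin.exists_castSucc_le_lt_succ ?_ ?_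
    · rw [partialSum_zero, ← h0]
      exact hE.monotone (Fin.zero_le _)
    · rw [partialSum_last, ← h1]
      exact hE (Fin.castSucc_lt_last i)
  choose g hg1 hg2 using hex
  have hlt {i : Fin k} {j : Fin (n + 1)} :
      E i.castSucc < partialSum w j ↔ (g i).castSucc < j := by
    refine ⟨fun h ↦ (monotone_partialSum w).reflect_lt ((hg1 i).trans_lt h), fun h ↦ ?_⟩
    exact (hg2 i).trans_le (monotone_partialSum w (Fin.castSucc_lt_iff_succ_le.1 h))
  have hmono : Monotone g := fun i i' h ↦ by
    have : E i.castSucc < partialSum w (g i').succ :=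
      (hE.monotone (Fin.castSucc_le_castSucc_iff.2 h)).trans_lt (hg2 i')
    exact Fin.castSucc_lt_succ_iff.1 (hlt.1 this)
  -- The pieces of `E` sent below `j` are those to the left of `partialSum w j`, so their lengths
  -- telescope.
  have hsum (j : Fin (n + 1)) : ∑ i : Fin k with (g i).castSucc < j,
      ofPartition E hE.monotone h0 h1 i = partialSum w j := by
    obtain ⟨r, hr⟩ := hw j
    have := Fin.sum_filter_castSucc_lt_sub E r
    rw [h0, sub_zero, hr] at this
    rw [← this]
    refine Finset.sum_congr ?_ fun _ _ ↦ rfl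
    ext i
    simp only [Finset.mem_filter, Finset.mem_univ, true_and, ← hlt, ← hr, hE.lt_iff_lt]
  refine ⟨⟨g, hmono⟩, ?_⟩
  ext j
  have hj := partialSum_succ w j
  rw [← hsum, ← hsum] at hj
  have : (Finset.univ.filter fun i : Fin k ↦ (g i).castSucc < j.succ) =
      (Finset.univ.filter fun i : Fin k ↦ (g i).castSucc < j.castSucc) ∪
      (Finset.univ.filter fun i : Fin k ↦ g i = j) := by
    ext i
    simp [le_iff_lt_or_eq]
  rw [this, Finset.sum_union, add_right_inj] at hj
  · rw [← hj]
    exact map_apply _ _ _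
  · rw [Finset.disjoint_filter]
    intro i _ hi h
    simp [h] at hi

/-- Any two points of simplices come from an interior point of a common simplex. -/
lemma exists_common_refinement (w : stdSimplex ℝ (Fin (n + 1))) (w' : stdSimplex ℝ (Fin (m + 1))) :
    ∃ k ≤ n + m + 2, ∃ v : stdSimplex ℝ (Fin (k + 1)), (∀ i, 0 < v i) ∧
      ∃ (g : Fin (k + 1) →o Fin (n + 1)) (g' : Fin (k + 1) →o Fin (m + 1)),
        map g v = w ∧ map g' v = w' := by
  classical
  let F : Finset ℝ := Finset.univ.image (partialSum w) ∪ Finset.univ.image (partialSum w')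
  have hF0 : (0 : ℝ) ∈ F := Finset.mem_union_left _
    (Finset.mem_image.2 ⟨0, Finset.mem_univ _, partialSum_zero w⟩)
  have hF1 : (1 : ℝ) ∈ F := Finset.mem_union_left _
    (Finset.mem_image.2 ⟨Fin.last _, Finset.mem_univ _, partialSum_last w⟩)
  have hFI : ∀ x ∈ F, x ∈ Set.Icc (0 : ℝ) 1 := by
    intro x hx
    rcases Finset.mem_union.1 hx with hx | hx
    all_goals
      obtain ⟨j, -, rfl⟩ := Finset.mem_image.1 hx
      exact partialSum_mem_Icc _ j
  have hcard : F.card ≤ (n + 2) + (m + 2) :=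
    (Finset.card_union_le _ _).trans (add_le_add
      (Finset.card_image_le.trans (by simp)) (Finset.card_image_le.trans (by simp)))
  have hcard2 : 1 < F.card := Finset.one_lt_card.2 ⟨0, hF0, 1, hF1, zero_ne_one⟩
  -- The `k + 2` cut points, including 0 and 1, bound `k + 1` pieces of positive length: an interior
  -- point of the `k`-simplex.
  obtain ⟨k, hk⟩ : ∃ k, F.card = k + 2 := ⟨F.card - 2, by lia⟩
  let E : Fin (k + 1 + 1) ↪o ℝ := F.orderEmbOfFin hk
  have hE : Set.range E = F := Finset.range_orderEmbOfFin F hk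
  have h0 : E 0 = 0 := by
    obtain ⟨r, hr⟩ := hE.symm ▸ (Finset.mem_coe.2 hF0)
    exact le_antisymm (hr ▸ E.monotone (Fin.zero_le r))
      (hFI _ (Finset.mem_coe.1 (hE ▸ Set.mem_range_self 0))).1
  have h1 : E (Fin.last _) = 1 := by
    obtain ⟨r, hr⟩ := hE.symm ▸ (Finset.mem_coe.2 hF1)
    exact le_antisymm (hFI _ (Finset.mem_coe.1 (hE ▸ Set.mem_range_self _))).2
      (hr ▸ E.monotone (Fin.le_last r))
  obtain ⟨g, hg⟩ := exists_map_ofPartition_eq E E.strictMono h0 h1 w (fun j ↦ hE ▸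
    Finset.mem_coe.2 (Finset.mem_union_left _ (Finset.mem_image_of_mem _ (Finset.mem_univ j))))
  obtain ⟨g', hg'⟩ := exists_map_ofPartition_eq E E.strictMono h0 h1 w' (fun j ↦ hE ▸
    Finset.mem_coe.2 (Finset.mem_union_right _ (Finset.mem_image_of_mem _ (Finset.mem_univ j))))
  exact ⟨k, by lia, _, fun i ↦ sub_pos.2 (E.strictMono i.castSucc_lt_succ), g, g', hg, hg'⟩

end stdSimplex

/-! ### The inverse of |X × Y| → |X| × |Y| on points -/

namespace SSet

open Opposite

/-- The morphism of the simplex category given by a monotone map. -/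
def homOfMonotone {n m : SimplexCategory} (g : Fin (m.len + 1) →o Fin (n.len + 1)) : m ⟶ n :=
  SimplexCategory.Hom.mk g

/-- Positivity of `v` makes the monotone maps unique; the bound on `k` leaves finitely many
refinements to consider in `continuous_pairMap`. -/
lemma exists_refinement {n m : SimplexCategory} (s : TopSimplex n) (t : TopSimplex m) :
    ∃ (k : ℕ) (_ : k ≤ n.len + m.len + 2) (v : TopSimplex ⦋k⦌) (_ : ∀ i, 0 < v i)
      (g : ⦋k⦌ ⟶ n) (h : ⦋k⦌ ⟶ m), _root_.stdSimplex.map g v = s ∧ _root_.stdSimplex.map h v = t := by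
  obtain ⟨k, hk, v, hv, g, h, hg, hh⟩ := _root_.stdSimplex.exists_common_refinement s t
  exact ⟨k, hk, v, hv, homOfMonotone g, homOfMonotone h, hg, hh⟩

lemma hom_eq_of_map_eq {n k : SimplexCategory} {a b : k ⟶ n} {v : TopSimplex k}
    (hv : ∀ i, 0 < v i) (h : _root_.stdSimplex.map a v = _root_.stdSimplex.map b v) : a = b := by
  apply SimplexCategory.Hom.ext
  apply OrderHom.ext
  exact _root_.stdSimplex.eq_of_map_eq a.toOrderHom.monotone b.toOrderHom.monotone hv h

lemma map_comp_topSimplex {k m n : SimplexCategory} (f : k ⟶ m) (g : m ⟶ n) (v : TopSimplex k) :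
    _root_.stdSimplex.map (f ≫ g) v = _root_.stdSimplex.map g (_root_.stdSimplex.map f v) := by
  rw [_root_.stdSimplex.map_comp_apply]
  rfl

variable {X Y : SSet.{u}}

/-- The pair of simplices `(x, y)`, restricted along `(g, h)`. -/
def pairSimplex {n m k : SimplexCategory} (x : X.obj (op n)) (y : Y.obj (op m)) (g : k ⟶ n)
    (h : k ⟶ m) : (X ⊗ Y : SSet.{u}).obj (op k) :=
  (X.map g.op x, Y.map h.op y)

lemma pairSimplex_comp {n m k l : SimplexCategory} (x : X.obj (op n)) (y : Y.obj (op m))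
    (g : k ⟶ n) (h : k ⟶ m) (f : l ⟶ k) :
    pairSimplex x y (f ≫ g) (f ≫ h) = (X ⊗ Y : SSet.{u}).map f.op (pairSimplex x y g h) := by
  refine Prod.ext ?_ ?_
  · exact ConcreteCategory.congr_hom (X.map_comp g.op f.op) x
  · exact ConcreteCategory.congr_hom (Y.map_comp h.op f.op) y

/-- Refine `v` and `v'` by a common interior point `z`. The two composites to `n` agree at `z`,
hence are equal, and likewise for `m`. -/
lemma simplexMap_pairSimplex_eq {n m k l : SimplexCategory} (x : X.obj (op n)) (y : Y.obj (op m))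
    {g : k ⟶ n} {h : k ⟶ m} {v : TopSimplex k} {g' : l ⟶ n} {h' : l ⟶ m} {v' : TopSimplex l}
    (hg : _root_.stdSimplex.map g v = _root_.stdSimplex.map g' v')
    (hh : _root_.stdSimplex.map h v = _root_.stdSimplex.map h' v') :
    simplexMap (pairSimplex x y g h) v = simplexMap (pairSimplex x y g' h') v' := by
  obtain ⟨r, -, z, hz, a, b, rfl, rfl⟩ := exists_refinement v v'
  rw [← simplexMap_map, ← simplexMap_map, ← pairSimplex_comp, ← pairSimplex_comp,
    hom_eq_of_map_eq hz (a := a ≫ g) (b := b ≫ g') (by simpa only [map_comp_topSimplex] using hg),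
    hom_eq_of_map_eq hz (a := a ≫ h) (b := b ≫ h') (by simpa only [map_comp_topSimplex] using hh)]

/-- The point of `|X ⊗ Y|` with given components, in terms of simplices of `X` and `Y`. -/
def pairMap {n m : SimplexCategory} (x : X.obj (op n)) (y : Y.obj (op m))
    (p : TopSimplex n × TopSimplex m) : |(X ⊗ Y : SSet.{u})| :=
  simplexMap (pairSimplex x y
    (exists_refinement p.1 p.2).choose_spec.choose_spec.choose_spec.choose_spec.choose
    (exists_refinement p.1 p.2).choose_spec.choose_spec.choose_spec.choose_spec.choose_spec.choose)
    (exists_refinement p.1 p.2).choose_spec.choose_spec.choose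

/-- Any representation may replace the one chosen in `pairMap`, and `v` need not be interior. -/
lemma pairMap_map {n m k : SimplexCategory} (x : X.obj (op n)) (y : Y.obj (op m)) (g : k ⟶ n)
    (h : k ⟶ m) (v : TopSimplex k) :
    pairMap x y (_root_.stdSimplex.map g v, _root_.stdSimplex.map h v) =
      simplexMap (pairSimplex x y g h) v := by
  have H := (exists_refinement (_root_.stdSimplex.map g v) (_root_.stdSimplex.map h v)
    ).choose_spec.choose_spec.choose_spec.choose_spec.choose_spec.choose_spec
  exact simplexMap_pairSimplex_eq x y H.1 H.2

/-- Finitely many simplices cover Δⁿ × Δᵐ by compactness-preserving maps: the surjection `Q` goes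
from a compact to a Hausdorff space, so it is a quotient map, and on each piece `pairMap` is a
characteristic map. -/
lemma continuous_pairMap {n m : SimplexCategory} (x : X.obj (op n)) (y : Y.obj (op m)) :
    Continuous (pairMap x y) := by
  let J := Σ k : Fin (n.len + m.len + 3), (⦋(k : ℕ)⦌ ⟶ n) × (⦋(k : ℕ)⦌ ⟶ m)
  let Q : (Σ j : J, TopSimplex ⦋(j.1 : ℕ)⦌) → TopSimplex n × TopSimplex m :=
    fun z ↦ (_root_.stdSimplex.map z.1.2.1 z.2, _root_.stdSimplex.map z.1.2.2 z.2)
  have hfin (a b : SimplexCategory) : Finite (a ⟶ b) :=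
    Finite.of_injective (fun f : a ⟶ b ↦ (⇑f : Fin (a.len + 1) → Fin (b.len + 1)))
      fun _ _ h ↦ ConcreteCategory.coe_ext h
  have hJ : Finite J := inferInstance
  have hmap {a b : SimplexCategory} (f : a ⟶ b) :
      Continuous fun v : TopSimplex a ↦ (_root_.stdSimplex.map f v : TopSimplex b) :=
    _root_.stdSimplex.continuous_map _
  have hQ : Continuous Q := by
    rw [continuous_sigma_iff]
    exact fun j ↦ (hmap j.2.1).prodMk (hmap j.2.2)
  have hQs : Function.Surjective Q := by
    rintro ⟨s, t⟩
    obtain ⟨k, hk, v, -, g, h, rfl, rfl⟩ := exists_refinement s t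
    exact ⟨⟨⟨⟨k, by lia⟩, g, h⟩, v⟩, rfl⟩
  have hq : IsQuotientMap Q := hQ.isClosedMap.isQuotientMap hQ hQs
  rw [hq.continuous_iff, continuous_sigma_iff]
  intro j
  refine (simplexMap (pairSimplex x y j.2.1 j.2.2)).continuous.congr fun v ↦ ?_
  exact (pairMap_map x y j.2.1 j.2.2 v).symm

lemma pairMap_map_left {n n' m : SimplexCategory} (f : n' ⟶ n) (x : X.obj (op n)) (y : Y.obj (op m))
    (s : TopSimplex n') (t : TopSimplex m) :
    pairMap (X.map f.op x) y (s, t) = pairMap x y (_root_.stdSimplex.map f s, t) := by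
  obtain ⟨k, -, v, -, g, h, rfl, rfl⟩ := exists_refinement s t
  rw [pairMap_map, ← map_comp_topSimplex, pairMap_map]
  have e := ConcreteCategory.congr_hom (X.map_comp f.op g.op) x
  exact congrArg (fun z : (X ⊗ Y : SSet.{u}).obj (op ⦋k⦌) ↦ simplexMap z v) (Prod.ext e.symm rfl)

lemma pairMap_map_right {n m m' : SimplexCategory} (f : m' ⟶ m) (x : X.obj (op n))
    (y : Y.obj (op m)) (s : TopSimplex n) (t : TopSimplex m') :
    pairMap x (Y.map f.op y) (s, t) = pairMap x y (s, _root_.stdSimplex.map f t) := by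
  obtain ⟨k, -, v, -, g, h, rfl, rfl⟩ := exists_refinement s t
  rw [pairMap_map, ← map_comp_topSimplex, pairMap_map]
  have e := ConcreteCategory.congr_hom (Y.map_comp f.op h.op) y
  exact congrArg (fun z : (X ⊗ Y : SSet.{u}).obj (op ⦋k⦌) ↦ simplexMap z v) (Prod.ext rfl e.symm)

variable (X Y) in
-- Descends one variable at a time, as a map of sets; continuity is treated separately.
lemma exists_prodInv : ∃ φ : |X| × |Y| → |(X ⊗ Y : SSet.{u})|,
    ∀ (n m : SimplexCategory) (x : X.obj (op n)) (y : Y.obj (op m)) s t,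
      φ (simplexMap x s, simplexMap y t) = pairMap x y (s, t) := by
  choose f hf using fun (m : SimplexCategory) (y : Y.obj (op m)) (t : TopSimplex m) ↦
    exists_desc (X := X) (fun n x s ↦ pairMap x y (s, t))
      (fun n' n φ x s ↦ pairMap_map_left φ x y s t)
  obtain ⟨g, hg⟩ := exists_desc (X := Y) f (fun m' m φ y t ↦ by
    funext a
    obtain ⟨n, x, s, rfl⟩ := exists_simplexMap_eq a
    rw [hf, hf, pairMap_map_right])
  exact ⟨fun p ↦ g p.2 p.1, fun n m x y s t ↦ (congrFun (hg m y t) _).trans (hf m y t n x s)⟩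

end SSet

/-! ### Continuity of the inverse for the k-topology -/

instance isGeneratedBy_compHaus_of_compactSpace {Y : Type} [TopologicalSpace Y] [CompactSpace Y]
    [T2Space Y] : IsGeneratedBy (fun K : CompHaus.{w} ↦ (K : Type w)) Y :=
  have : IsGeneratedBy (fun K : CompHaus.{w} ↦ (K : Type w)) (ULift.{w} Y) :=
    inferInstanceAs (IsGeneratedBy (fun K : CompHaus.{w} ↦ (K : Type w))
      (CompHaus.of (ULift.{w} Y)))
  IsQuotientMap.isGeneratedBy (Y := ULift.{w} Y) (Z := Y) Homeomorph.ulift.isQuotientMap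

instance locallyCompactSpace_compHaus (K : CompHaus.{w}) : LocallyCompactSpace K :=
  have h (Y : Type w) [TopologicalSpace Y] [CompactSpace Y] [T2Space Y] :
    LocallyCompactSpace Y := inferInstance
  h K

instance isGeneratedBy_compHaus_prod (K K' : CompHaus.{w}) :
    IsGeneratedBy (fun K : CompHaus.{w} ↦ (K : Type w)) (K × K') :=
  inferInstanceAs (IsGeneratedBy (fun K : CompHaus.{w} ↦ (K : Type w)) (CompHaus.of (K × K')))

namespace Topology.IsQuotientMap

variable {ι : Type*} {K : ι → Type*} [∀ i, TopologicalSpace (K i)]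
  [∀ i, LocallyCompactSpace (K i)] [∀ i j, IsGeneratedBy K (K i × K j)]
  {A A' B B' T : Type*} [TopologicalSpace A] [TopologicalSpace A'] [TopologicalSpace B]
  [TopologicalSpace B'] [TopologicalSpace T]

/-- Currying turns the hypothesis into a continuous map from `A'` to a mapping space. It factors
through the quotient `A`, and uncurrying gives the claim. -/
lemma continuousGeneratedBy_prod_right [IsGeneratedBy K A'] {p : A' → A} (hp : IsQuotientMap p)
    {h : B × A → T} (hh : ContinuousGeneratedBy K fun z : B × A' ↦ h (z.1, p z.2)) :
    ContinuousGeneratedBy K h := by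
  let G : ContinuousMapGeneratedBy K A' (ContinuousMapGeneratedBy K B T) :=
    ContinuousMapGeneratedBy.curryEquiv ⟨_, hh⟩
  have hslice (a : A) : ContinuousGeneratedBy K fun b ↦ h (b, a) := by
    obtain ⟨a', rfl⟩ := hp.surjective a
    exact (G a').prop
  let F : A → ContinuousMapGeneratedBy K B T := fun a ↦ ⟨fun b ↦ h (b, a), hslice a⟩
  have hF : Continuous F := by
    rw [hp.continuous_iff, IsGeneratedBy.continuous_iff K]
    exact G.prop
  exact (ContinuousMapGeneratedBy.curryEquiv.symm ⟨F, hF.continuousGeneratedBy⟩).prop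

lemma continuousGeneratedBy_prod_left [IsGeneratedBy K A'] {p : A' → A} (hp : IsQuotientMap p)
    {h : A × B → T} (hh : ContinuousGeneratedBy K fun z : A' × B ↦ h (p z.1, z.2)) :
    ContinuousGeneratedBy K h := by
  have : ContinuousGeneratedBy K fun z : B × A ↦ h (z.2, z.1) :=
    hp.continuousGeneratedBy_prod_right (hh.comp continuous_swap.continuousGeneratedBy)
  exact this.comp continuous_swap.continuousGeneratedBy

end Topology.IsQuotientMap

namespace SSet

open Opposite

variable {X Y : SSet.{u}}

lemma isOpenEmbedding_simplexSum (i : Σ n : SimplexCategory, X.obj (op n)) :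
    IsOpenEmbedding (fun a : TopSimplex i.1 ↦ (⟨i, a⟩ : SimplexSum X)) :=
  @IsOpenEmbedding.sigmaMk _ (fun x : Σ n : SimplexCategory, X.obj (op n) ↦ TopSimplex x.1) _ i

/-- Both factors may be replaced by sums of simplices, whose product is covered by the open pieces
Δⁿ × Δᵐ. -/
lemma continuousGeneratedBy_of_simplexMap {T : Type*} [TopologicalSpace T] {φ : |X| × |Y| → T}
    (hφ : ∀ (n m : SimplexCategory) (x : X.obj (op n)) (y : Y.obj (op m)),
      Continuous fun p : TopSimplex n × TopSimplex m ↦ φ (simplexMap x p.1, simplexMap y p.2)) :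
    ContinuousGeneratedBy (fun K : CompHaus.{u} ↦ (K : Type u)) φ := by
  refine (isQuotientMap_sumMap (X := X)).continuousGeneratedBy_prod_left
    ((isQuotientMap_sumMap (X := Y)).continuousGeneratedBy_prod_right
      (Continuous.continuousGeneratedBy ?_))
  rw [continuous_iff_continuousAt]
  rintro ⟨⟨i, a⟩, ⟨j, b⟩⟩
  have he : IsOpenEmbedding (fun p : TopSimplex i.1 × TopSimplex j.1 ↦
      ((⟨i, p.1⟩, ⟨j, p.2⟩) : SimplexSum X × SimplexSum Y)) :=
    IsOpenEmbedding.prodMap (f := fun a ↦ (⟨i, a⟩ : SimplexSum X))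
      (g := fun b ↦ (⟨j, b⟩ : SimplexSum Y))
      (isOpenEmbedding_simplexSum i) (isOpenEmbedding_simplexSum j)
  exact (he.continuousAt_iff (x := (a, b))).1 (hφ i.1 j.1 i.2 j.2).continuousAt

variable (X Y) in
/-- The canonical map `|X ⊗ Y| → |X| ×ₖ |Y|`. -/
def realizationComparison (z : |(X ⊗ Y : SSet.{u})|) : KProd |X| |Y| :=
  KProd.pair (SSet.toTop.map (CartesianMonoidalCategory.fst X Y) z)
    (SSet.toTop.map (CartesianMonoidalCategory.snd X Y) z)

lemma realizationComparison_simplexMap {n : SimplexCategory} (z : (X ⊗ Y : SSet.{u}).obj (op n))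
    (t : TopSimplex n) : realizationComparison X Y (simplexMap z t) =
      KProd.pair (simplexMap z.1 t) (simplexMap z.2 t) := by
  rw [realizationComparison, toTop_map_simplexMap, toTop_map_simplexMap]
  rfl

lemma continuous_realizationComparison : Continuous (realizationComparison X Y) := by
  rw [realization_continuous_iff]
  intro n z
  have h : realizationComparison X Y ∘ simplexMap z =
      WithGeneratedByTopology.equiv.symm ∘ fun t ↦ (simplexMap z.1 t, simplexMap z.2 t) :=
    funext fun t ↦ realizationComparison_simplexMap z t
  rw [h, IsGeneratedBy.equiv_symm_comp_continuous_iff]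
  exact (simplexMap z.1).continuous.prodMk (simplexMap z.2).continuous

variable (X Y) in
/-- Geometric realization commutes with binary products of compactly generated spaces. -/
theorem isHomeomorph_realizationComparison : IsHomeomorph (realizationComparison X Y) := by
  obtain ⟨φ, hφ⟩ := exists_prodInv X Y
  have hφc : ContinuousGeneratedBy (fun K : CompHaus.{u} ↦ (K : Type u)) φ :=
    continuousGeneratedBy_of_simplexMap fun n m x y ↦ by
      simpa only [hφ] using continuous_pairMap x y
  refine isHomeomorph_iff_exists_inverse.2 ⟨continuous_realizationComparison,
    φ ∘ WithGeneratedByTopology.equiv, ?_, ?_, ?_⟩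
  · intro z
    obtain ⟨n, z, t, rfl⟩ := exists_simplexMap_eq z
    rw [realizationComparison_simplexMap]
    refine (hφ n n z.1 z.2 t t).trans ?_
    have h := pairMap_map z.1 z.2 (𝟙 n) (𝟙 n) t
    have e : _root_.stdSimplex.map (𝟙 n : n ⟶ n) t = t := _root_.stdSimplex.map_id_apply t
    rw [e] at h
    rw [h]
    have h1 := ConcreteCategory.congr_hom (X.map_id (op n)) z.1
    have h2 := ConcreteCategory.congr_hom (Y.map_id (op n)) z.2
    exact congrArg (fun a : (X ⊗ Y : SSet.{u}).obj (op n) ↦ simplexMap a t) (Prod.ext h1 h2)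
  · intro p
    obtain ⟨n, x, s, hx⟩ := exists_simplexMap_eq (WithGeneratedByTopology.equiv p).1
    obtain ⟨m, y, t, hy⟩ := exists_simplexMap_eq (WithGeneratedByTopology.equiv p).2
    obtain rfl : KProd.pair (simplexMap x s) (simplexMap y t) = p := by
      rw [hx, hy]
      rfl
    obtain ⟨k, -, v, -, g, h, rfl, rfl⟩ := exists_refinement s t
    refine (congrArg (realizationComparison X Y) ((hφ n m x y _ _).trans
      (pairMap_map x y g h v))).trans ?_
    rw [realizationComparison_simplexMap, ← simplexMap_map, ← simplexMap_map]
    rfl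
  · rw [WithGeneratedByTopology.continuous_from_iff]
    exact hφc

end SSet

/-! ### Classifying spaces of product categories -/

namespace ClassifyingSpace

open Opposite

variable {C D : Type u} [Category.{v} C] [Category.{v} D]

variable (C D) in
/-- The nerve of a product of categories is the product of the nerves. -/
def nerveProdIso : nerve (C × D) ≅ (nerve C ⊗ nerve D : SSet.{max u v}) :=
  NatIso.ofComponents (fun _ ↦ Equiv.toIso
    { toFun F := (F ⋙ CategoryTheory.Prod.fst C D, F ⋙ CategoryTheory.Prod.snd C D)
      invFun p := CategoryTheory.Functor.prod' p.1 p.2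
      left_inv _ := rfl
      right_inv _ := rfl }) (fun _ ↦ rfl)

variable (C D) in
theorem isHomeomorph_comparison : IsHomeomorph (comparison C D) := by
  have h : comparison C D = SSet.realizationComparison (nerve C) (nerve D) ∘
      TopCat.homeoOfIso (SSet.toTop.mapIso (nerveProdIso C D)) := by
    funext z
    have h1 : nerveMap (CategoryTheory.Prod.fst C D) =
      (nerveProdIso C D).hom ≫ CartesianMonoidalCategory.fst (nerve C) (nerve D) := rfl
    have h2 : nerveMap (CategoryTheory.Prod.snd C D) =
      (nerveProdIso C D).hom ≫ CartesianMonoidalCategory.snd (nerve C) (nerve D) := rfl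
    simp only [comparison, map, h1, h2, Functor.map_comp]
    rfl
  rw [h]
  exact (SSet.isHomeomorph_realizationComparison _ _).comp (Homeomorph.isHomeomorph _)

end ClassifyingSpace

/-! ### Homotopies from simplicial homotopies and natural transformations -/

namespace SSet

open Opposite

variable {X Y : SSet.{u}}

/-- For locally compact `S`, continuity of `f` is that of the curried map from |X| to `C(S, T)`,
which can be tested on simplices. -/
lemma continuous_prod_realization {S T : Type*} [TopologicalSpace S] [LocallyCompactSpace S]
    [TopologicalSpace T] {f : S × |X| → T}
    (h : ∀ (n : SimplexCategory) (x : X.obj (op n)),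
      Continuous fun p : TopSimplex n × S ↦ f (p.2, simplexMap x p.1)) : Continuous f := by
  have hslice (z : |X|) : Continuous fun s ↦ f (s, z) := by
    obtain ⟨n, x, t, rfl⟩ := exists_simplexMap_eq z
    exact (h n x).comp (Continuous.prodMk_right t)
  let g : |X| → C(S, T) := fun z ↦ ⟨fun s ↦ f (s, z), hslice z⟩
  have hg : Continuous g := by
    rw [realization_continuous_iff]
    exact fun n x ↦ ContinuousMap.continuous_of_continuous_uncurry _ (h n x)
  exact (ContinuousMap.continuous_uncurry_of_continuous ⟨g, hg⟩).comp continuous_swap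

/-- The unit interval is the topological `1`-simplex. -/
def unitIntervalHomeo : TopSimplex ⦋1⦌ ≃ₜ I := stdSimplexHomeomorphUnitInterval

/-- A simplicial homotopy induces a homotopy between maps of realizations. -/
theorem exists_homotopy (h : (X ⊗ Δ[1] : SSet.{u}) ⟶ Y) :
    ∃ H : C(I × |X|, |Y|), ∀ (n : SimplexCategory) (x : X.obj (op n)) (a : n ⟶ ⦋1⦌)
      (s : TopSimplex n), H (unitIntervalHomeo (_root_.stdSimplex.map a s), simplexMap x s) =
        simplexMap (h.app (op n) (x, stdSimplex.objEquiv.symm a)) s := by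
  let c := (isHomeomorph_realizationComparison X Δ[1]).homeomorph
  -- The characteristic map of the fundamental simplex carries the interval into |Δ[1]|.
  let y : (Δ[1] : SSet.{u}).obj (op ⦋1⦌) := stdSimplex.objEquiv.symm (𝟙 _)
  let P : I × |X| → KProd |X| |(Δ[1] : SSet.{u})| := fun p ↦
    KProd.pair p.2 (simplexMap y (unitIntervalHomeo.symm p.1))
  let H : I × |X| → |Y| := fun p ↦ SSet.toTop.map h (c.symm (P p))
  have hP (n : SimplexCategory) (x : X.obj (op n)) :
      Continuous fun p : TopSimplex n × I ↦ P (p.2, simplexMap x p.1) :=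
    (IsGeneratedBy.equiv_symm_comp_continuous_iff (X := fun K : CompHaus.{u} ↦ (K : Type u))
      (fun p : TopSimplex n × I ↦ (simplexMap x p.1,
        simplexMap y (unitIntervalHomeo.symm p.2)))).2 (by fun_prop)
  have hH : Continuous H := continuous_prod_realization fun n x ↦
    (SSet.toTop.map h).hom.continuous.comp (c.symm.continuous.comp (hP n x))
  refine ⟨⟨H, hH⟩, fun n x a s ↦ ?_⟩
  let z : (X ⊗ Δ[1] : SSet.{u}).obj (op n) := (x, stdSimplex.objEquiv.symm a)
  refine Eq.trans (congrArg (SSet.toTop.map h) ?_) (toTop_map_simplexMap h z s)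
  rw [Homeomorph.symm_apply_eq]
  refine Eq.trans ?_ (realizationComparison_simplexMap z s).symm
  simp only [P, Homeomorph.symm_apply_apply]
  rw [← simplexMap_map]
  exact congrArg (fun b : (Δ[1] : SSet.{u}).obj (op n) ↦
    KProd.pair (simplexMap x s) (simplexMap b s))
    (stdSimplex.objEquiv.injective (Category.comp_id a))

end SSet

namespace ClassifyingSpace

open Opposite SSet

variable {C D : Type u} [Category.{v} C] [Category.{v} D]

/-- The simplicial homotopy given by a natural transformation. -/
def nerveHomotopy {F G : C ⥤ D} (α : F ⟶ G) :
    (nerve C ⊗ Δ[1] : SSet.{max u v}) ⟶ nerve D where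
  -- `α` is a functor from [1] to `C ⥤ D`, uncurried to [1] × C ⥤ D; a simplex of the product is a
  -- chain in [1] × C.
  app _ := ↾fun p ↦ (Functor.prod' (SimplexCategory.toCat.map (stdSimplex.objEquiv p.2)).toFunctor
    p.1) ⋙ Functor.uncurry.obj (ComposableArrows.mk₁ α)
  naturality _ _ _ := rfl

/-- The path in the classifying space given by a morphism. -/
def edgePath {c d : C} (f : c ⟶ d) : C(I, ClassifyingSpace C) :=
  (simplexMap (X := nerve C) (n := ⦋1⦌) (ComposableArrows.mk₁ f)).comp
    ⟨unitIntervalHomeo.symm, unitIntervalHomeo.symm.continuous⟩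

lemma vertex_eq (c : C) :
    vertex c = simplexMap (X := nerve C) (n := ⦋0⦌) (ComposableArrows.mk₀ c) default := rfl

lemma simplexMap_const (c : C) (n : SimplexCategory) (t : TopSimplex n) :
    simplexMap (X := nerve C) (n := n) ((CategoryTheory.Functor.const _).obj c) t = vertex c := by
  let f : n ⟶ ⦋0⦌ := SimplexCategory.const n ⦋0⦌ 0
  have h := simplexMap_map (X := nerve C) f (ComposableArrows.mk₀ c) t
  rw [vertex_eq, Subsingleton.elim default (_root_.stdSimplex.map f t)]
  refine Eq.trans ?_ h
  rfl

lemma unitIntervalHomeo_map_const (n : SimplexCategory) (i : Fin 2) (t : TopSimplex n) :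
    unitIntervalHomeo (_root_.stdSimplex.map (SimplexCategory.const n ⦋1⦌ i) t) =
      unitIntervalHomeo (_root_.stdSimplex.vertex i) := by
  have h : SimplexCategory.const n ⦋1⦌ i =
    SimplexCategory.const n ⦋0⦌ 0 ≫ SimplexCategory.const ⦋0⦌ ⦋1⦌ i := rfl
  rw [h, map_comp_topSimplex]
  rw [Subsingleton.elim (_root_.stdSimplex.map (SimplexCategory.const n ⦋0⦌ 0) t)
    (_root_.stdSimplex.vertex 0), _root_.stdSimplex.map_vertex]
  rfl

/-- A natural transformation induces a homotopy between maps of classifying spaces. -/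
theorem exists_homotopy {F G : C ⥤ D} (α : F ⟶ G) :
    ∃ H : C(I × ClassifyingSpace C, ClassifyingSpace D), (∀ z, H (0, z) = map F z) ∧
      (∀ z, H (1, z) = map G z) ∧ ∀ c t, H (t, vertex c) = edgePath (α.app c) t := by
  obtain ⟨H, hH⟩ := SSet.exists_homotopy (nerveHomotopy α)
  refine ⟨H, fun z ↦ ?_, fun z ↦ ?_, fun c t ↦ ?_⟩
  · obtain ⟨n, x, s, rfl⟩ := exists_simplexMap_eq z
    have h := hH n x (SimplexCategory.const n ⦋1⦌ 0) s
    rw [unitIntervalHomeo_map_const] at h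
    refine h.trans (Eq.trans ?_ (toTop_map_simplexMap (nerveMap F) x s).symm)
    refine congrArg (fun b : (nerve D).obj (op n) ↦ simplexMap b s) ?_
    refine CategoryTheory.Functor.ext (fun i ↦ rfl) (fun i j f ↦ ?_)
    change (𝟙 F : F ⟶ F).app (x.obj i) ≫ F.map (x.map f) = 𝟙 _ ≫ F.map (x.map f) ≫ 𝟙 _
    simp
  · obtain ⟨n, x, s, rfl⟩ := exists_simplexMap_eq z
    have h := hH n x (SimplexCategory.const n ⦋1⦌ 1) s
    rw [unitIntervalHomeo_map_const] at h
    refine h.trans (Eq.trans ?_ (toTop_map_simplexMap (nerveMap G) x s).symm)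
    refine congrArg (fun b : (nerve D).obj (op n) ↦ simplexMap b s) ?_
    refine CategoryTheory.Functor.ext (fun i ↦ rfl) (fun i j f ↦ ?_)
    change (𝟙 G : G ⟶ G).app (x.obj i) ≫ G.map (x.map f) = 𝟙 _ ≫ G.map (x.map f) ≫ 𝟙 _
    simp
  · obtain ⟨s, rfl⟩ := unitIntervalHomeo.surjective t
    rw [← simplexMap_const c ⦋1⦌ s]
    -- The track of the vertex `c` is read off from the degenerate 1-simplex at `c` paired with the
    -- identity of [1].
    have h := hH ⦋1⦌ ((CategoryTheory.Functor.const _).obj c) (𝟙 _) s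
    have e : _root_.stdSimplex.map (𝟙 (⦋1⦌ : SimplexCategory)) s = s :=
      _root_.stdSimplex.map_id_apply s
    rw [e] at h
    refine h.trans ?_
    simp only [edgePath, ContinuousMap.comp_apply, ContinuousMap.coe_mk,
      Homeomorph.symm_apply_apply]
    refine congrArg (fun b : (nerve D).obj (op ⦋1⦌) ↦ simplexMap b s) ?_
    refine ComposableArrows.ext₁ rfl rfl ?_
    change α.app c ≫ G.map (𝟙 c) = 𝟙 _ ≫ α.app c ≫ 𝟙 _
    simp

end ClassifyingSpace

/-! ### Weights of objects and contraction to a terminal object -/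

namespace ClassifyingSpace

open Opposite SSet Limits

variable {C D E : Type u} [Category.{v} C] [Category.{v} D] [Category.{v} E]

open scoped Classical in
/-- The total weight of an object of `C` in the barycentric coordinates of a point of the
classifying space is continuous. -/
lemma exists_weight (c : C) : ∃ h : C(ClassifyingSpace C, I),
    ∀ d, h (vertex d) = if d = c then 1 else 0 := by
  let w (n : SimplexCategory) (x : ComposableArrows C n.len) (t : TopSimplex n) : ℝ :=
    ∑ i with x.obj i = c, t i
  have hw (n : SimplexCategory) (x : ComposableArrows C n.len) (t : TopSimplex n) :
      w n x t ∈ I := by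
    refine ⟨Finset.sum_nonneg fun i _ ↦ stdSimplex.zero_le t i, ?_⟩
    rw [← stdSimplex.sum_eq_one t]
    exact Finset.sum_le_sum_of_subset_of_nonneg (Finset.filter_subset _ _)
      fun i _ _ ↦ stdSimplex.zero_le t i
  have hc (n : SimplexCategory) (x : ComposableArrows C n.len) : Continuous (w n x) :=
    continuous_finsetSum _ fun i _ ↦ (continuous_apply i).comp continuous_subtype_val
  let f (n : SimplexCategory) (x : (nerve C).obj (op n)) :
      C(TopSimplex n, ULift.{max u v} I) :=
    ⟨fun t ↦ ⟨⟨w n x t, hw n x t⟩⟩, continuous_uliftUp.comp ((hc n x).subtype_mk _)⟩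
  -- Restriction along `φ` relabels the vertices while `φ` pushes the weights forward, so the total
  -- weight of `c` is unchanged.
  have hf ⦃m n : SimplexCategory⦄ (φ : m ⟶ n) (x : (nerve C).obj (op n)) (t : TopSimplex m) :
      f m ((nerve C).map φ.op x) t = f n x (stdSimplex.map φ t) :=
    ULift.ext _ _ (Subtype.ext (stdSimplex.sum_filter_map φ t (fun i ↦ x.obj i = c)).symm)
  refine ⟨⟨fun z ↦ (realizationDesc f hf z).down,
    continuous_uliftDown.comp (realizationDesc f hf).continuous⟩, fun d ↦ ?_⟩
  have hd := realizationDesc_simplexMap f hf (ComposableArrows.mk₀ d) (n := ⦋0⦌) default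
  refine (congrArg ULift.down hd).trans (Subtype.ext ?_)
  change w ⦋0⦌ (ComposableArrows.mk₀ d) default = _
  have h1 : ∑ i, (default : TopSimplex ⦋0⦌) i = 1 := stdSimplex.sum_eq_one _
  by_cases hdc : d = c
  · rw [if_pos hdc]
    refine Eq.trans ?_ h1
    exact Finset.sum_congr (Finset.filter_true_of_mem fun _ _ ↦ hdc) fun _ _ ↦ rfl
  · rw [if_neg hdc]
    exact Finset.sum_eq_zero fun i hi ↦ absurd (Finset.mem_filter.1 hi).2 hdc

lemma vertex_injective : Function.Injective (vertex : C → ClassifyingSpace C) := by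
  classical
  intro c d h
  obtain ⟨w, hw⟩ := exists_weight c
  have h1 := hw c
  rw [h, hw d, if_pos rfl] at h1
  by_contra hcd
  simp [Ne.symm hcd] at h1

/-- Once `c` is identified with `d`, terminality forces `f` to be the identity, whose 1-simplex is
degenerate. -/
lemma edgePath_of_isTerminal {c d : C} (hd : IsTerminal d) (h : c = d) (f : c ⟶ d) :
    edgePath f = ContinuousMap.const I (vertex d) := by
  subst h
  obtain rfl : f = 𝟙 c := hd.hom_ext _ _
  ext t
  rw [ContinuousMap.const_apply, ← simplexMap_const c ⦋1⦌ (unitIntervalHomeo.symm t)]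
  refine congrArg (fun b : (nerve C).obj (op ⦋1⦌) ↦ simplexMap b (unitIntervalHomeo.symm t)) ?_
  refine ComposableArrows.ext₁ rfl rfl ?_
  change 𝟙 c = 𝟙 _ ≫ 𝟙 c ≫ 𝟙 _
  simp

/-- The classifying space of a category with a terminal object contracts to it. -/
lemma exists_contraction {d : C} (hd : IsTerminal d) :
    ∃ K : C(I × ClassifyingSpace C, ClassifyingSpace C), (∀ z, K (0, z) = z) ∧
      (∀ z, K (1, z) = vertex d) ∧ ∀ t, K (t, vertex d) = vertex d := by
  let α : 𝟭 C ⟶ (CategoryTheory.Functor.const C).obj d :=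
    { app c := hd.from c
      naturality _ _ _ := hd.hom_ext _ _ }
  obtain ⟨K, h0, h1, hK⟩ := exists_homotopy α
  refine ⟨K, fun z ↦ (h0 z).trans ?_, fun z ↦ (h1 z).trans ?_, fun t ↦ (hK d t).trans ?_⟩
  · obtain ⟨n, x, t, rfl⟩ := exists_simplexMap_eq z
    exact toTop_map_simplexMap (nerveMap (𝟭 C)) x t
  · obtain ⟨n, x, t, rfl⟩ := exists_simplexMap_eq z
    refine (toTop_map_simplexMap (nerveMap ((CategoryTheory.Functor.const C).obj d)) x t).trans ?_
    exact simplexMap_const d n t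
  · rw [edgePath_of_isTerminal hd rfl]
    rfl

lemma map_vertex (F : C ⥤ D) (c : C) : map F (vertex c) = vertex (F.obj c) := by
  rw [vertex_eq, vertex_eq, ← nerveMap_app_mk₀]
  exact toTop_map_simplexMap (nerveMap F) (ComposableArrows.mk₀ c) default

lemma map_id_apply (z : ClassifyingSpace C) : map (𝟭 C) z = z := by
  obtain ⟨n, x, t, rfl⟩ := exists_simplexMap_eq z
  exact toTop_map_simplexMap (nerveMap (𝟭 C)) x t

lemma map_comp_apply (F : C ⥤ D) (G : D ⥤ E) (z : ClassifyingSpace C) :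
    map (F ⋙ G) z = map G (map F z) := by
  have h : nerveMap (F ⋙ G) = nerveMap F ≫ nerveMap G := rfl
  simp only [map, h, Functor.map_comp]
  rfl

lemma map_const_apply (d : D) (z : ClassifyingSpace C) :
    map ((CategoryTheory.Functor.const C).obj d) z = vertex d := by
  obtain ⟨n, x, t, rfl⟩ := exists_simplexMap_eq z
  exact (toTop_map_simplexMap (nerveMap ((CategoryTheory.Functor.const C).obj d)) x t).trans
    (simplexMap_const d n t)

lemma comparison_map_prod (F : E ⥤ C) (G : E ⥤ D) (z : ClassifyingSpace E) :
    comparison C D (map (CategoryTheory.Functor.prod' F G) z) = KProd.pair (map F z) (map G z) := by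
  rw [comparison, ← map_comp_apply, ← map_comp_apply]
  rfl

variable (C D) in
/-- The inverse of the canonical map `B(C × D) → BC × BD`. -/
def comparisonInv : C(KProd (ClassifyingSpace C) (ClassifyingSpace D), ClassifyingSpace (C × D)) :=
  ⟨(isHomeomorph_comparison C D).homeomorph.symm, Homeomorph.continuous _⟩

lemma comparisonInv_comparison (z : ClassifyingSpace (C × D)) :
    comparisonInv C D (comparison C D z) = z :=
  (isHomeomorph_comparison C D).homeomorph.symm_apply_apply z

lemma comparison_comparisonInv (p : KProd (ClassifyingSpace C) (ClassifyingSpace D)) :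
    comparison C D (comparisonInv C D p) = p :=
  (isHomeomorph_comparison C D).homeomorph.apply_symm_apply p

lemma homotopic_map {F G : C ⥤ D} (α : F ⟶ G) : (map F).Homotopic (map G) := by
  obtain ⟨H, h0, h1, -⟩ := exists_homotopy α
  exact ⟨⟨H, h0, h1⟩⟩

/-! ### The multiplication of a monoidal category -/

section Monoidal

variable (C) [MonoidalCategory C]

/-- The multiplication of the classifying space of a monoidal category. -/
def mul : C(KProd (ClassifyingSpace C) (ClassifyingSpace C), ClassifyingSpace C) :=
  (map (tensor C)).comp (comparisonInv C C)

variable {C}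

lemma mul_comparison (z : ClassifyingSpace (C × C)) :
    mul C (comparison C C z) = map (tensor C) z :=
  congrArg (map (tensor C)) (comparisonInv_comparison z)

/-- Translates formulas in `mul` into functors out of one category, where natural transformations
apply. -/
lemma mul_map (F G : E ⥤ C) (z : ClassifyingSpace E) :
    mul C (KProd.pair (map F z) (map G z)) = map (CategoryTheory.Functor.prod' F G ⋙ tensor C) z := by
  rw [← comparison_map_prod, mul_comparison, map_comp_apply]

lemma hUnitalAlong_mul : HUnitalAlong (mul C) (vertex (𝟙_ C)) (edgePath (λ_ (𝟙_ C)).hom) := by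
  constructor
  · let α : CategoryTheory.Functor.prod' ((CategoryTheory.Functor.const C).obj (𝟙_ C)) (𝟭 C) ⋙
      tensor C ⟶ 𝟭 C :=
      { app c := (λ_ c).hom
        naturality c d f := by simp }
    obtain ⟨H, h0, h1, h2⟩ := exists_homotopy α
    refine ⟨H, fun z ↦ (h0 z).trans ?_, fun z ↦ (h1 z).trans (map_id_apply z), h2 _⟩
    rw [← mul_map, map_const_apply, map_id_apply]
  · let α : CategoryTheory.Functor.prod' (𝟭 C) ((CategoryTheory.Functor.const C).obj (𝟙_ C)) ⋙
      tensor C ⟶ 𝟭 C :=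
      { app c := (ρ_ c).hom
        naturality c d f := by simp }
    obtain ⟨H, h0, h1, h2⟩ := exists_homotopy α
    refine ⟨H, fun z ↦ (h0 z).trans ?_, fun z ↦ (h1 z).trans (map_id_apply z), fun t ↦ ?_⟩
    · rw [← mul_map, map_const_apply, map_id_apply]
    -- The two unitors coincide at the unit object, so both homotopies move `e` along the same path.
    · rw [unitors_equal]
      exact h2 _ t

lemma hAssociative_mul : HAssociative (mul C) := by
  let P₁ : C × C × C ⥤ C := CategoryTheory.Prod.fst C (C × C)
  let P₂ : C × C × C ⥤ C := CategoryTheory.Prod.snd C (C × C) ⋙ CategoryTheory.Prod.fst C C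
  let P₃ : C × C × C ⥤ C := CategoryTheory.Prod.snd C (C × C) ⋙ CategoryTheory.Prod.snd C C
  let T : C × C × C ⥤ C := CategoryTheory.Functor.prod' P₁
    (CategoryTheory.Functor.prod' P₂ P₃ ⋙ tensor C) ⋙ tensor C
  let T' : C × C × C ⥤ C := CategoryTheory.Functor.prod'
    (CategoryTheory.Functor.prod' P₁ P₂ ⋙ tensor C) P₃ ⋙ tensor C
  let α : T ⟶ T' :=
    { app c := (α_ c.1 c.2.1 c.2.2).inv
      naturality c d f := by
        dsimp [T, T', P₁, P₂, P₃]
        simp }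
  let j : C(KProd (ClassifyingSpace C) (KProd (ClassifyingSpace C) (ClassifyingSpace C)),
      ClassifyingSpace (C × C × C)) :=
    (comparisonInv C (C × C)).comp
      (KProd.lift KProd.fst ((comparisonInv C C).comp KProd.snd))
  -- Every triple comes from a single point of B(C × C × C), so both bracketings become maps induced
  -- by functors.
  have key (p : KProd (ClassifyingSpace C) (KProd (ClassifyingSpace C) (ClassifyingSpace C))) :
      ∃ z, j p = z ∧ p = KProd.pair (map P₁ z) (KProd.pair (map P₂ z) (map P₃ z)) := by
    refine ⟨_, rfl, ?_⟩
    have h := comparison_comparisonInv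
      (KProd.lift KProd.fst ((comparisonInv C C).comp KProd.snd) p)
    have h1 : map P₁ (j p) = KProd.fst p := congrArg KProd.fst h
    have h2 : map (CategoryTheory.Prod.snd C (C × C)) (j p) = comparisonInv C C (KProd.snd p) :=
      congrArg KProd.snd h
    have h3 := comparison_comparisonInv (KProd.snd p)
    rw [← h2, comparison, ← map_comp_apply, ← map_comp_apply] at h3
    rw [h1, h3]
    rfl
  have e1 : (mul C).comp (KProd.lift KProd.fst ((mul C).comp (KProd.lift
      (KProd.fst.comp KProd.snd) (KProd.snd.comp KProd.snd)))) = (map T).comp j := by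
    ext p
    obtain ⟨z, hz, rfl⟩ := key p
    rw [ContinuousMap.comp_apply, ContinuousMap.comp_apply, hz]
    refine Eq.trans ?_ (mul_map _ _ z)
    rw [← mul_map]
    rfl
  have e2 : (mul C).comp (KProd.lift ((mul C).comp (KProd.lift KProd.fst
      (KProd.fst.comp KProd.snd))) (KProd.snd.comp KProd.snd)) = (map T').comp j := by
    ext p
    obtain ⟨z, hz, rfl⟩ := key p
    rw [ContinuousMap.comp_apply, ContinuousMap.comp_apply, hz]
    refine Eq.trans ?_ (mul_map _ _ z)
    rw [← mul_map]
    rfl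
  change ContinuousMap.Homotopic _ _
  rw [e1, e2]
  exact (homotopic_map α).comp (.refl j)

lemma hCommutative_mul [BraidedCategory C] : HCommutative (mul C) := by
  let P₁ : C × C ⥤ C := CategoryTheory.Prod.fst C C
  let P₂ : C × C ⥤ C := CategoryTheory.Prod.snd C C
  let α : tensor C ⟶ CategoryTheory.Functor.prod' P₂ P₁ ⋙ tensor C :=
    { app c := (β_ c.1 c.2).hom
      naturality c d f := by
        dsimp [P₁, P₂]
        simp }
  have e : (mul C).comp (KProd.lift KProd.snd KProd.fst) =
      (map (CategoryTheory.Functor.prod' P₂ P₁ ⋙ tensor C)).comp (comparisonInv C C) := by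
    ext p
    rw [ContinuousMap.comp_apply, ContinuousMap.comp_apply, ← mul_map]
    conv_lhs => rw [← comparison_comparisonInv p]
    rfl
  change ContinuousMap.Homotopic _ _
  rw [e]
  exact (homotopic_map α).comp (.refl _)

end Monoidal

end ClassifyingSpace

/-! ### H-space structure from a contraction -/

namespace HSpace

variable {X : Type w} [TopologicalSpace X] {e : X}

/-- A multiplication on a space with a contraction `K` onto the base point `e` and a continuous
function `h` with `h e = 1`: of two points, the one with the smaller value of `h` is moved towards
`e`, all the way if the two values agree and hardly if the other point is close to `e`. -/
def contractionMul (K : C(I × X, X)) (K1 : ∀ x, K (1, x) = e) (h : C(X, I)) : C(X × X, X) where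
  toFun p := if (h p.1 : ℝ) ≤ h p.2 then
      K (Set.projIcc 0 1 zero_le_one (1 - ((h p.2 : ℝ) - h p.1)), p.1)
    else K (Set.projIcc 0 1 zero_le_one (1 - ((h p.1 : ℝ) - h p.2)), p.2)
  continuous_toFun := by
    refine continuous_if_le (by fun_prop) (by fun_prop) (Continuous.continuousOn ?_)
      (Continuous.continuousOn ?_) fun p hp ↦ ?_
    · exact K.continuous.comp ((continuous_projIcc.comp (by fun_prop)).prodMk continuous_fst)
    · exact K.continuous.comp ((continuous_projIcc.comp (by fun_prop)).prodMk continuous_snd)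
    -- Where the two values of `h` agree, both branches are at time 1 of the contraction, hence
    -- equal `e`.
    · rw [hp, sub_self, sub_zero, Set.projIcc_right]
      exact (K1 _).trans (K1 _).symm

section

variable {K : C(I × X, X)} {K1 : ∀ x, K (1, x) = e} {h : C(X, I)}

lemma contractionMul_base_right (he : h e = 1) (x : X) :
    contractionMul K K1 h (x, e) = K (h x, x) := by
  have hx : (h x : ℝ) ≤ h e := by rw [he]; exact (h x).2.2
  have e1 : contractionMul K K1 h (x, e) = _ := if_pos hx
  rw [e1, he]
  simp

lemma contractionMul_comm (x y : X) :
    contractionMul K K1 h (x, y) = contractionMul K K1 h (y, x) := by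
  rcases lt_trichotomy (h x : ℝ) (h y) with hxy | hxy | hxy
  · exact (if_pos hxy.le).trans (if_neg (not_le.2 hxy)).symm
  · refine (if_pos hxy.le).trans (Eq.trans ?_ (if_pos hxy.ge).symm)
    simp only [hxy, sub_self, sub_zero, Set.projIcc_right]
    exact (K1 _).trans (K1 _).symm
  · exact (if_neg (not_le.2 hxy)).trans (if_pos hxy.le).symm

end

/-- Both maps contract to the constant map `e`; this settles associativity, commutativity and the
comparison with μ. -/
lemma homotopic_of_contraction {K : C(I × X, X)} (K0 : ∀ x, K (0, x) = x) (K1 : ∀ x, K (1, x) = e)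
    {Y : Type*} [TopologicalSpace Y] (f g : C(Y, X)) : f.Homotopic g := by
  have key (f : C(Y, X)) : f.Homotopic (ContinuousMap.const Y e) :=
    ⟨⟨⟨fun p ↦ K (p.1, f p.2), by fun_prop⟩, fun y ↦ K0 _, fun y ↦ K1 _⟩⟩
  exact (key f).trans (key g).symm

/-- A space with a contraction onto `e` that fixes `e` is an H-space. -/
abbrev ofContraction (K : C(I × X, X)) (K0 : ∀ x, K (0, x) = x) (K1 : ∀ x, K (1, x) = e)
    (Ke : ∀ t, K (t, e) = e) (h : C(X, I)) (he : h e = 1) : HSpace X where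
  hmul := contractionMul K K1 h
  e := e
  hmul_e_e := by rw [contractionMul_base_right he, Ke]
  eHmul :=
    -- Multiplication by `e` is `x ↦ K (h x, x)`; scaling the time from `h x` down to 0 ends at the
    -- identity.
    { toFun p := K (unitInterval.symm p.1 * h p.2, p.2)
      continuous_toFun := by fun_prop
      map_zero_left x := by
        simpa using ((contractionMul_comm e x).trans (contractionMul_base_right he x)).symm
      map_one_left x := by simpa using K0 x
      prop' t x hx := by
        obtain rfl : x = e := hx
        simp [contractionMul_base_right he, Ke] }
  hmulE :=
    { toFun p := K (unitInterval.symm p.1 * h p.2, p.2)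
      continuous_toFun := by fun_prop
      map_zero_left x := by simpa using (contractionMul_base_right he x).symm
      map_one_left x := by simpa using K0 x
      prop' t x hx := by
        obtain rfl : x = e := hx
        simp [contractionMul_base_right he, Ke] }

end HSpace

namespace ClassifyingSpace

variable {L : Type u} [Category.{v} L] [MonoidalCategory.{v} L] [MarkovCategory L]

/-- Vertices are injective, so the hypothesis gives I ⊗ I = I as objects; as I is terminal, the edge
of the unitor is then constant. -/
lemma hUnitalAlong_const
    (h : mul L (KProd.pair (vertex (𝟙_ L)) (vertex (𝟙_ L))) = vertex (𝟙_ L)) :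
    HUnitalAlong (mul L) (vertex (𝟙_ L)) (ContinuousMap.const I (vertex (𝟙_ L))) := by
  have hI : 𝟙_ L ⊗ 𝟙_ L = 𝟙_ L := by
    apply vertex_injective
    rw [← map_const_apply (𝟙_ L) (vertex (𝟙_ L)), mul_map, map_vertex, map_const_apply] at h
    exact h
  rw [← edgePath_of_isTerminal MarkovCategory.isTerminalUnit hI (λ_ (𝟙_ L)).hom]
  exact hUnitalAlong_mul

end ClassifyingSpace

end

theorem mainTheorem3 (L : Type u) [Category.{v} L] [MonoidalCategory.{v} L] [MarkovCategory L] :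
    IsHomeomorph (ClassifyingSpace.comparison L L) ∧
    ∃ μ : C(KProd (ClassifyingSpace L) (ClassifyingSpace L), ClassifyingSpace L),
      (∀ z : ClassifyingSpace (L × L),
        μ (ClassifyingSpace.comparison L L z) =
          ClassifyingSpace.map (MonoidalCategory.tensor L) z) ∧
      (∃ γ : C(I, ClassifyingSpace L),
        HUnitalAlong μ (ClassifyingSpace.vertex (𝟙_ L)) γ) ∧
      (μ (KProd.pair (ClassifyingSpace.vertex (𝟙_ L)) (ClassifyingSpace.vertex (𝟙_ L))) =
          ClassifyingSpace.vertex (𝟙_ L) →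
        HUnitalAlong μ (ClassifyingSpace.vertex (𝟙_ L))
          (ContinuousMap.const I (ClassifyingSpace.vertex (𝟙_ L)))) ∧
      HAssociative μ ∧
      HCommutative μ ∧
      ∃ h : HSpace (ClassifyingSpace L),
        h.e = ClassifyingSpace.vertex (𝟙_ L) ∧
        μ.Homotopic (h.hmul.comp KProd.toProd) ∧
        h.IsAssociative ∧
        h.IsCommutative := by
  refine ⟨ClassifyingSpace.isHomeomorph_comparison L L, ClassifyingSpace.mul L,
    ClassifyingSpace.mul_comparison, ⟨_, ClassifyingSpace.hUnitalAlong_mul⟩,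
    ClassifyingSpace.hUnitalAlong_const, ClassifyingSpace.hAssociative_mul,
    ClassifyingSpace.hCommutative_mul, ?_⟩
  obtain ⟨K, K0, K1, Ke⟩ :=
    ClassifyingSpace.exists_contraction (MarkovCategory.isTerminalUnit (C := L))
  obtain ⟨w, hw⟩ := ClassifyingSpace.exists_weight (𝟙_ L)
  exact ⟨HSpace.ofContraction K K0 K1 Ke w ((hw _).trans (if_pos rfl)), rfl,
    HSpace.homotopic_of_contraction K0 K1 _ _, HSpace.homotopic_of_contraction K0 K1 _ _,
    HSpace.homotopic_of_contraction K0 K1 _ _⟩
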